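/- Let $X\subset\mathbb{R}^3$ be a compact, connected, orientable embedded surface of class $C^2$ with (possibly empty) boundary $\partial X$, and let $\mathcal{H}^2$ be the two-dimensional Hausdorff measure. For a surface $Y$ and $r>0$ write $U_r(X)=\{x\in\mathbb{R}^3: d(x,X)<r\}$ and $\mathcal{N}_r(Y)=\{y+t\,n_Y(y): y\in Y,\ -r<t<r\}$, where $n_Y(y)$ is a unit normal of $Y$ at $y$ (defined by continuity at boundary points). Let $\pi_X(x)$ denote the nearest point of $X$ to $x$. For $\eta>0$ let $X^{+\eta}=X\cup\{x+s\,\nu(x): x\in\partial X,\ 0<s\le\eta\}$, where $\nu(x)$ is the outward unit conormal, i.e. the unit vector tangent to $X$ at $x$, orthogonal to $\partial X$ and pointing out of $X$. A triangulation $\mathcal{T}$ is a finite set of nondegenerate (flat) triangles in $\mathbb{R}^3$, any two different ones of which are disjoint or meet exactly in a common vertex or a common edge, and whose union, also denoted $\mathcal{T}$, is a two-dimensional topological manifold with boundary. Let $(\mathcal{T}_h)_h$ be a family of triangulations indexed by parameters $h>0$ tending to $0$ (for example a sequence $h_k\downarrow 0$). Put $\mathcal{T}_h^{\mathrm{in}}=\mathcal{T}_h\cap\mathcal{N}_h(X)$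 and $\mathcal{T}_h^{\mathrm{out}}=\mathcal{T}_h\setminus\mathcal{N}_h(X)$. Suppose that the triangulations are $h$-admissible for $X$, that is, for a constant $C$ independent of $h$ and all sufficiently small $h$: 1. every point of $U_h(X)$ has a unique nearest point in $X$, and $\mathcal{T}_h\subset U_h(X)$; 2. $\mathcal{T}_h\subset\mathcal{N}_h(X^{+\eta})$ for some $\eta>0$ (possibly depending on $h$) for which $X^{+\eta}$ is an embedded $C^1$ surface with boundary; 3. $\pi_X$ maps $\mathcal{T}_h^{\mathrm{in}}$ bijectively onto $X$; 4. $\mathcal{H}^2(\mathcal{T}_h^{\mathrm{out}})\le C h$; 5. every triangle of $\mathcal{T}_h$ has diameter at most $C h$. Let $\alpha_{\max}^h$ be the supremum, over all $x\in\mathcal{T}_h^{\mathrm{in}}$ and all triangles $T$ of $\mathcal{T}_h$ containing $x$, of the angle in $[0,\pi/2]$ between the normal line of $X$ at $\pi_X(x)$ and the normal line of $T$, and suppose that $\alpha_{\max}^h=O(h)$ as $h\to0$. Then $\mathcal{H}^2(X)<\infty$ and $$\lim_{h\to 0}\mathcal{H}^2(\mathcal{T}_h)=\mathcal{H}^2(X).$$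 -/

import Mathlib

open Set Filter Topology MeasureTheory
open scoped RealInnerProductSpace

/-- Euclidean three-space. -/
abbrev R3 : Type := EuclideanSpace ℝ (Fin 3)

/-- Two-dimensional Hausdorff measure on `ℝ³`, normalised so that it is Lebesgue measure on planes. -/
noncomputable def area (A : Set R3) : ENNReal := μHE[2] A

/-! ### Surfaces with boundary in `ℝ³` -/

/-- `Φ` is a `C^k` diffeomorphism between open subsets of `ℝ³` which straightens `Y`: in the
coordinates given by `Φ`, the set `Y` is the closed half-plane `{y₂ = 0, y₀ ≥ 0}`. -/
structure IsFlatChart (k : WithTop ℕ∞) (Y : Set R3) (Φ : OpenPartialHomeomorph R3 R3) : Prop where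
  contDiffOn : ContDiffOn ℝ k Φ Φ.source
  contDiffOn_symm : ContDiffOn ℝ k Φ.symm Φ.target
  mem_iff : ∀ x ∈ Φ.source, x ∈ Y ↔ (Φ x) 2 = 0 ∧ 0 ≤ (Φ x) 0

/-- `Y` is an embedded two-dimensional `C^k` submanifold with (possibly empty) boundary of `ℝ³`.
A chart with `(Φ x) 0 > 0` is a chart at an interior point. -/
def IsSurface (k : WithTop ℕ∞) (Y : Set R3) : Prop :=
  ∀ x ∈ Y, ∃ Φ : OpenPartialHomeomorph R3 R3, IsFlatChart k Y Φ ∧ x ∈ Φ.source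

/-- The boundary of a `C²` surface. -/
def surfaceBoundary (X : Set R3) : Set R3 :=
  {x | x ∈ X ∧ ∃ Φ : OpenPartialHomeomorph R3 R3,
    IsFlatChart 2 X Φ ∧ x ∈ Φ.source ∧ (Φ x) 0 = 0}

/-- `n` is a unit vector orthogonal to all tangent vectors of `Y` at `x`. For a surface (also at
its boundary points) the tangent vectors span the tangent plane, so there are exactly two such
vectors, opposite to each other. -/
def IsUnitNormalAt (Y : Set R3) (x n : R3) : Prop :=
  ‖n‖ = 1 ∧ ∀ w ∈ tangentConeAt ℝ Y x, ⟪n, w⟫ = 0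

/-- A compact, connected, orientable `C²` surface with boundary in `ℝ³`. An orientation is a
continuous field of unit normals. -/
structure IsCompactOrientedSurface (X : Set R3) : Prop where
  isSurface : IsSurface 2 X
  isCompact : IsCompact X
  isConnected : IsConnected X
  orientable : ∃ n : R3 → R3, ContinuousOn n X ∧ ∀ x ∈ X, IsUnitNormalAt X x (n x)

/-! ### Projection and neighbourhoods -/

/-- `y` is a nearest point of `X` to `x`. -/
def IsProjection (X : Set R3) (x y : R3) : Prop :=
  y ∈ X ∧ dist x y = Metric.infDist x X

/-- The nearest-point projection `π_X` (used only at points with a unique nearest point). -/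
noncomputable def proj (X : Set R3) (x : R3) : R3 :=
  Classical.epsilon (IsProjection X x)

/-- The set `U_r(X)` of points at distance less than `r` from `X`. -/
def tube (X : Set R3) (r : ℝ) : Set R3 := {x | Metric.infDist x X < r}

/-- `U_r(X)` is a tubular neighbourhood: each of its points has a unique projection on `X`. -/
def IsTubular (X : Set R3) (r : ℝ) : Prop := ∀ x ∈ tube X r, ∃! y, IsProjection X x y

/-- The set `N_r(Y) = {x + t n(x) : x ∈ Y, -r < t < r}`, where `n(x)` is a unit normal. As `t`
takes both signs the choice of the normal does not matter. -/
def normalNhd (Y : Set R3) (r : ℝ) : Set R3 :=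
  {z | ∃ x ∈ Y, ∃ n : R3, IsUnitNormalAt Y x n ∧ ∃ t ∈ Ioo (-r) r, z = x + t • n}

/-! ### Extension of a surface across its boundary -/

/-- `v` is the outward unit conormal of `X` at the boundary point `x`: a unit vector, tangent to
`X`, orthogonal to the boundary, and such that `-v` points into `X`. -/
structure IsOutwardConormalAt (X : Set R3) (x v : R3) : Prop where
  norm_eq : ‖v‖ = 1
  orthogonal_normal : ∀ n, IsUnitNormalAt X x n → ⟪v, n⟫ = 0
  orthogonal_boundary : ∀ w ∈ tangentConeAt ℝ (surfaceBoundary X) x, ⟪v, w⟫ = 0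
  inward : -v ∈ posTangentConeAt X x

/-- The extension `X^{+η} = X ∪ {x + s ν(x) : x ∈ ∂X, 0 < s ≤ η}`. -/
def extendedSurface (X : Set R3) (η : ℝ) : Set R3 :=
  X ∪ {z | ∃ x ∈ surfaceBoundary X, ∃ v, IsOutwardConormalAt X x v ∧
    ∃ s ∈ Ioc 0 η, z = x + s • v}

/-! ### Triangulations -/

/-- A triangulated surface in `ℝ³`: a finite set of nondegenerate triangles (given by their sets of
vertices) such that two different triangles are disjoint or meet exactly in a common vertex or a
common edge, and whose union is a two-dimensional topological manifold with boundary. -/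
structure Triangulation where
  triangles : Finset (Finset R3)
  card_eq : ∀ s ∈ triangles, s.card = 3
  indep : ∀ s ∈ triangles, AffineIndependent ℝ (fun p : s => (p : R3))
  inter_eq : ∀ s ∈ triangles, ∀ t ∈ triangles, s ≠ t →
    convexHull ℝ (s : Set R3) ∩ convexHull ℝ (t : Set R3) = convexHull ℝ ((s : Set R3) ∩ t)
  manifold : Nonempty (ChartedSpace (EuclideanHalfSpace 2)
    ↥(⋃ s ∈ triangles, convexHull ℝ (s : Set R3)))

namespace Triangulation

/-- The union of the triangles. -/
def carrier (T : Triangulation) : Set R3 := ⋃ s ∈ T.triangles, convexHull ℝ (s : Set R3)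

/-- The largest diameter of a triangle. -/
noncomputable def diam (T : Triangulation) : ℝ :=
  sSup ((fun s : Finset R3 => Metric.diam (convexHull ℝ (s : Set R3))) '' T.triangles)

/-- The part `T ∩ N_r(X)` of the triangulation. -/
def inPart (T : Triangulation) (X : Set R3) (r : ℝ) : Set R3 := T.carrier ∩ normalNhd X r

/-- The remaining part `T \ N_r(X)`. -/
def outPart (T : Triangulation) (X : Set R3) (r : ℝ) : Set R3 := T.carrier \ normalNhd X r

end Triangulation

/-- The angle in `[0, π/2]` between the lines spanned by two vectors. -/
noncomputable def lineAngle (u v : R3) : ℝ :=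
  min (InnerProductGeometry.angle u v) (Real.pi - InnerProductGeometry.angle u v)

/-- `a` is the angle between the unit normal of `X` at `π_X(x)` and the unit normal of a triangle
of `T` that contains `x`. -/
def IsNormalAngleAt (X : Set R3) (T : Triangulation) (x : R3) (a : ℝ) : Prop :=
  ∃ s ∈ T.triangles, x ∈ convexHull ℝ (s : Set R3) ∧
    ∃ m : R3, ‖m‖ = 1 ∧ m ∈ (vectorSpan ℝ (s : Set R3))ᗮ ∧
    ∃ n : R3, IsUnitNormalAt X (proj X x) n ∧ a = lineAngle n m

/-- The maximal angle `α_max`: the supremum of the angles between normals over all points of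
`T ∩ N_h(X)` and all triangles containing the point. -/
noncomputable def maxAngle (X : Set R3) (h : ℝ) (T : Triangulation) : ℝ :=
  sSup {a | ∃ x ∈ T.inPart X h, IsNormalAngleAt X T x a}

/-- `T` is an `h`-admissible triangulation for `X`, with `C` as the constant in the two bounds of
the form `O(h)`. -/
structure IsAdmissible (X : Set R3) (C h : ℝ) (T : Triangulation) : Prop where
  pos : 0 < h
  tubular : IsTubular X h
  subset_tube : T.carrier ⊆ tube X h
  subset_extension : ∃ η : ℝ, 0 < η ∧ IsSurface 1 (extendedSurface X η) ∧
    T.carrier ⊆ normalNhd (extendedSurface X η) h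
  bijOn : BijOn (proj X) (T.inPart X h) X
  area_outPart_le : area (T.outPart X h) ≤ ENNReal.ofReal (C * h)
  diam_le : T.diam ≤ C * h

/-!
The limit is obtained by comparing `X` with the part `T ∩ N_h(X)` of the triangulation through the
nearest-point projection, which maps this part bijectively onto `X`; the remaining part has area
`O(h)`.

All that is used of the `C²` regularity of `X` is a constant `K` such that `X` leaves each of its
tangent planes at most quadratically, `|⟪n(x), y - x⟫| ≤ K ‖y - x‖²`, and such that the unit normals
satisfy `‖n(x) - n(y)‖ ≤ K ‖x - y‖`, up to the sign of one of them. Locally, both hold because `X`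
lies in the zero set of a `C²` function with nonvanishing gradient; compactness makes them global
(`exists_normalBoundsAt`).

The first bound implies that `x + t n(x)` projects to `x` when `|t| < h` and `2 h K < 1`, and that
the projection is Lipschitz on `N_h(X)` with constant `(1 - 2 h K)⁻¹`. Hence the area of `X` is at
most `(1 - 2 h K)⁻²` times the area of `T ∩ N_h(X)` (`area_le_area_inPart`).

For the converse, let `p = x + t n` and `q = y + s m` lie in one triangle with unit normal `μ`, where
`n` and `m` are within `c = O(h)` of `μ`. Then `p - q = (x - y) + (t - s) n + s (n - m)`. In the inner
product with `p - q`, the middle term is small since `p - q` is orthogonal to `μ` and therefore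
nearly orthogonal to `n`, and the last one is small by the second bound and `|s| < h`. So the inverse
of the projection is Lipschitz on each triangle with constant `(1 + h K) (1 + c) / (1 - c)`
(`norm_normal_add_sub_le`). The projections of the triangles overlap only in the images of edges,
which have area zero, so the estimates for the triangles can be added (`area_inPart_le`). Both
constants tend to `1`.
-/

/-! ### Unit normals in a flat chart -/

lemma R3.sum_coord_smul (v : R3) :
    v = v 0 • EuclideanSpace.single 0 (1 : ℝ) + v 1 • EuclideanSpace.single 1 (1 : ℝ)
      + v 2 • EuclideanSpace.single 2 (1 : ℝ) := by
  ext i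
  fin_cases i <;> simp

lemma IsFlatChart.contDiffAt {k : WithTop ℕ∞} {Y : Set R3} {Φ : OpenPartialHomeomorph R3 R3}
    (h : IsFlatChart k Y Φ) {x : R3} (hx : x ∈ Φ.source) : ContDiffAt ℝ k Φ x :=
  h.contDiffOn.contDiffAt (Φ.open_source.mem_nhds hx)

lemma IsFlatChart.contDiffAt_symm {k : WithTop ℕ∞} {Y : Set R3}
    {Φ : OpenPartialHomeomorph R3 R3} (h : IsFlatChart k Y Φ) {x : R3} (hx : x ∈ Φ.source) :
    ContDiffAt ℝ k Φ.symm (Φ x) :=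
  h.contDiffOn_symm.contDiffAt (Φ.open_target.mem_nhds (Φ.map_source hx))

/-- The function whose zero set contains the surface in the domain of a flat chart. -/
def chartHeight (Φ : OpenPartialHomeomorph R3 R3) (z : R3) : ℝ := Φ z 2

lemma IsFlatChart.contDiffAt_chartHeight {k : WithTop ℕ∞} {Y : Set R3}
    {Φ : OpenPartialHomeomorph R3 R3} (h : IsFlatChart k Y Φ) {x : R3} (hx : x ∈ Φ.source) :
    ContDiffAt ℝ k (chartHeight Φ) x :=
  (contDiffAt_euclidean.1 (h.contDiffAt hx)) 2

/-- In a flat chart the tangent vectors of the surface include the first two coordinate vectors,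
also at boundary points. -/
lemma IsFlatChart.fderiv_symm_mem_tangentConeAt {k : WithTop ℕ∞} (hk : k ≠ 0) {Y : Set R3}
    {Φ : OpenPartialHomeomorph R3 R3} (h : IsFlatChart k Y Φ) {x : R3} (hx : x ∈ Φ.source)
    (hxY : x ∈ Y) {v : R3} (hv0 : 0 ≤ v 0) (hv2 : v 2 = 0) :
    fderiv ℝ Φ.symm (Φ x) v ∈ tangentConeAt ℝ Y x := by
  obtain ⟨h2, h0⟩ := (h.mem_iff x hx).1 hxY
  have hd : HasFDerivAt Φ.symm (fderiv ℝ Φ.symm (Φ x)) (Φ x) :=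
    ((h.contDiffAt_symm hx).differentiableAt hk).hasFDerivAt
  let s : Set R3 := {w | w 2 = 0 ∧ 0 ≤ w 0} ∩ Φ.target
  have hvs : v ∈ tangentConeAt ℝ s (Φ x) := by
    rw [tangentConeAt_inter_nhds (Φ.open_target.mem_nhds (Φ.map_source hx))]
    refine mem_tangentConeAt_of_add_smul_mem (l := 𝓝[>] (0 : ℝ)) (c := id) ?_ ?_
    · exact tendsto_id'.2 (nhdsWithin_mono _ fun t ht => ne_of_gt ht)
    · filter_upwards [self_mem_nhdsWithin] with t ht
      have : 0 ≤ t * v 0 := mul_nonneg (le_of_lt ht) hv0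
      constructor
      · simp [h2, hv2]
      · simp only [id, PiLp.add_apply, PiLp.smul_apply, smul_eq_mul]
        linarith
  have himg : Φ.symm '' s ⊆ Y := by
    rintro _ ⟨w, ⟨hw, hwt⟩, rfl⟩
    rw [h.mem_iff _ (Φ.map_target hwt), Φ.right_inv hwt]
    exact hw
  have := (hd.hasFDerivWithinAt (s := s)).mapsTo_tangent_cone hvs
  rw [Φ.left_inv hx] at this
  exact tangentConeAt_mono himg this

lemma IsFlatChart.fderiv_chartHeight_apply {k : WithTop ℕ∞} (hk : k ≠ 0) {Y : Set R3}
    {Φ : OpenPartialHomeomorph R3 R3} (h : IsFlatChart k Y Φ) {x : R3} (hx : x ∈ Φ.source)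
    (w : R3) : fderiv ℝ (chartHeight Φ) x w = fderiv ℝ Φ x w 2 := by
  have hd : HasFDerivAt Φ (fderiv ℝ Φ x) x :=
    ((h.contDiffAt hx).differentiableAt hk).hasFDerivAt
  have : HasFDerivAt (chartHeight Φ) _ x :=
    (EuclideanSpace.proj (2 : Fin 3) : R3 →L[ℝ] ℝ).hasFDerivAt.comp x hd
  rw [this.fderiv]
  rfl

lemma IsFlatChart.fderiv_symm_fderiv {k : WithTop ℕ∞} (hk : k ≠ 0) {Y : Set R3}
    {Φ : OpenPartialHomeomorph R3 R3} (h : IsFlatChart k Y Φ) {x : R3} (hx : x ∈ Φ.source)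
    (w : R3) : fderiv ℝ Φ.symm (Φ x) (fderiv ℝ Φ x w) = w := by
  have hd : HasFDerivAt Φ (fderiv ℝ Φ x) x :=
    ((h.contDiffAt hx).differentiableAt hk).hasFDerivAt
  have hd' : HasFDerivAt Φ.symm (fderiv ℝ Φ.symm (Φ x)) (Φ x) :=
    ((h.contDiffAt_symm hx).differentiableAt hk).hasFDerivAt
  refine DFunLike.congr_fun
    ((hd'.comp x hd).unique ((hasFDerivAt_id x).congr_of_eventuallyEq ?_)) w
  filter_upwards [Φ.open_source.mem_nhds hx] with z hz
  simp [Φ.left_inv hz]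

lemma IsFlatChart.fderiv_chartHeight_ne_zero {k : WithTop ℕ∞} (hk : k ≠ 0) {Y : Set R3}
    {Φ : OpenPartialHomeomorph R3 R3} (h : IsFlatChart k Y Φ) {x : R3} (hx : x ∈ Φ.source) :
    fderiv ℝ (chartHeight Φ) x ≠ 0 := by
  intro h0
  have hinj : Function.Injective (fderiv ℝ Φ x) :=
    Function.LeftInverse.injective (h.fderiv_symm_fderiv hk hx)
  obtain ⟨w, hw⟩ := (LinearMap.injective_iff_surjective (f := (fderiv ℝ Φ x).toLinearMap)).1 hinj
    (EuclideanSpace.single 2 (1 : ℝ))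
  have h1 := h.fderiv_chartHeight_apply hk hx w
  rw [h0, show fderiv ℝ Φ x w = _ from hw] at h1
  simp at h1

/-- A unit normal is proportional to the gradient of the last chart coordinate. -/
lemma IsFlatChart.exists_inner_eq {k : WithTop ℕ∞} (hk : k ≠ 0) {Y : Set R3}
    {Φ : OpenPartialHomeomorph R3 R3} (h : IsFlatChart k Y Φ) {x n : R3} (hx : x ∈ Φ.source)
    (hxY : x ∈ Y) (hn : IsUnitNormalAt Y x n) :
    ∃ c : ℝ, ∀ w, ⟪n, w⟫ = c * fderiv ℝ (chartHeight Φ) x w := by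
  have hz : ∀ i : Fin 3, i ≠ 2 →
      ⟪n, fderiv ℝ Φ.symm (Φ x) (EuclideanSpace.single i (1 : ℝ))⟫ = 0 := by
    intro i hi
    refine hn.2 _ (h.fderiv_symm_mem_tangentConeAt hk hx hxY ?_ ?_)
    · by_cases h0 : (0 : Fin 3) = i <;> simp [h0]
    · simp [hi.symm]
  refine ⟨⟪n, fderiv ℝ Φ.symm (Φ x) (EuclideanSpace.single 2 (1 : ℝ))⟫, fun w => ?_⟩
  conv_lhs => rw [← h.fderiv_symm_fderiv hk hx w, R3.sum_coord_smul (fderiv ℝ Φ x w)]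
  simp only [map_add, map_smul, inner_add_right, inner_smul_right]
  rw [hz 0 (by decide), hz 1 (by decide), h.fderiv_chartHeight_apply hk hx]
  ring

/-- Unit vectors at an angle of at most `π / 2` are close if `n` is small on the plane orthogonal to
`m`: the component `w = n - ⟪n, m⟫ m` of `n` in this plane satisfies
`‖n - m‖² = 2 (1 - ⟪n, m⟫) ≤ 2 (1 - ⟪n, m⟫²) = 2 ‖w‖²`. -/
lemma norm_sub_le_of_inner_le {n m : R3} (hn : ‖n‖ = 1) (hm : ‖m‖ = 1) (hnm : 0 ≤ ⟪n, m⟫)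
    {δ : ℝ} (hδ : 0 ≤ δ) (h : ∀ w, ⟪m, w⟫ = 0 → ⟪n, w⟫ ≤ δ * ‖w‖) : ‖n - m‖ ≤ 2 * δ := by
  set w : R3 := n - ⟪n, m⟫ • m with hwdef
  have h1 : ⟪n, m⟫ ≤ 1 := by simpa [hn, hm] using real_inner_le_norm n m
  have hmw : ⟪m, w⟫ = 0 := by
    rw [hwdef, inner_sub_right, inner_smul_right, real_inner_self_eq_norm_sq, hm,
      real_inner_comm]
    ring
  have hnw : ⟪n, w⟫ = 1 - ⟪n, m⟫ ^ 2 := by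
    rw [hwdef, inner_sub_right, inner_smul_right, real_inner_self_eq_norm_sq, hn]
    ring
  have hww : ‖w‖ ^ 2 = 1 - ⟪n, m⟫ ^ 2 := by
    rw [← real_inner_self_eq_norm_sq]
    nth_rw 1 [hwdef]
    rw [inner_sub_left, inner_smul_left, hmw, hnw]
    simp
  have hw := h w hmw
  have hd : ‖n - m‖ ^ 2 = 2 - 2 * ⟪n, m⟫ := by
    rw [norm_sub_sq_real, hn, hm]; ring
  have hwδ : ‖w‖ ≤ δ ∨ ‖w‖ = 0 := by
    rcases eq_or_lt_of_le (norm_nonneg w) with h0 | h0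
    · exact Or.inr h0.symm
    · left
      refine le_of_mul_le_mul_right ?_ h0
      nlinarith
  have hle : ‖n - m‖ ^ 2 ≤ 2 * ‖w‖ ^ 2 := by nlinarith
  rcases hwδ with h2 | h2
  · have := norm_nonneg w
    exact abs_le_of_sq_le_sq' (by nlinarith) (by linarith) |>.2
  · have h3 : ‖n - m‖ = 0 := by
      rw [h2] at hle
      nlinarith [norm_nonneg (n - m)]
    linarith

/-! ### Curvature bounds for a compact `C²` surface -/

/-- The two consequences of a curvature bound for a surface `X` that are used, at a pair of points
`(x, y)`: the surface leaves its tangent plane at most quadratically, and unit normals are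
Lipschitz. In the second part the sign condition selects compatible orientations. -/
def NormalBoundsAt (X : Set R3) (K : ℝ) (x y : R3) : Prop :=
  ∀ n, IsUnitNormalAt X x n → |⟪n, y - x⟫| ≤ K * ‖y - x‖ ^ 2 ∧
    ∀ m, IsUnitNormalAt X y m → 0 ≤ ⟪n, m⟫ → ‖n - m‖ ≤ K * ‖y - x‖

lemma NormalBoundsAt.mono {X : Set R3} {K K' : ℝ} {x y : R3} (h : NormalBoundsAt X K x y)
    (hK : K ≤ K') : NormalBoundsAt X K' x y := fun n hn =>
  ⟨(h n hn).1.trans (by gcongr), fun m hm hnm => ((h n hn).2 m hm hnm).trans (by gcongr)⟩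

/-- With `f` the last chart coordinate, a unit normal is `n = c ∇f(x)` with `|c| = 1 / ‖∇f(x)‖`
bounded near `x₀`, and `∇f` is Lipschitz near `x₀`. The first bound is the Taylor estimate for `f`
between two of its zeros. -/
lemma IsFlatChart.eventually_normalBoundsAt {X : Set R3} {Φ : OpenPartialHomeomorph R3 R3}
    (h : IsFlatChart 2 X Φ) {x₀ : R3} (hx₀ : x₀ ∈ Φ.source) :
    ∃ K : ℝ, ∃ U ∈ 𝓝 x₀, ∀ x ∈ U, ∀ y ∈ U, x ∈ X → y ∈ X → NormalBoundsAt X K x y := by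
  set f := chartHeight Φ with hf
  have hC : ContDiffAt ℝ 2 f x₀ := h.contDiffAt_chartHeight hx₀
  have hC1 : ContDiffAt ℝ 1 (fderiv ℝ f) x₀ := hC.fderiv_right (by norm_num)
  obtain ⟨L, t, ht, hL⟩ := hC1.exists_lipschitzOnWith
  have h0 : fderiv ℝ f x₀ ≠ 0 := h.fderiv_chartHeight_ne_zero two_ne_zero hx₀
  set a : ℝ := ‖fderiv ℝ f x₀‖ / 2 with ha
  have ha0 : 0 < a := half_pos (norm_pos_iff.2 h0)
  have hlow : ∀ᶠ x in 𝓝 x₀, a < ‖fderiv ℝ f x‖ :=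
    hC1.continuousAt.norm.eventually (lt_mem_nhds (half_lt_self (norm_pos_iff.2 h0)))
  obtain ⟨r, hr, hball⟩ := Metric.eventually_nhds_iff_ball.1
    (hlow.and ((Filter.eventually_mem_set.2 ht).and (Φ.open_source.mem_nhds hx₀)))
  refine ⟨2 * (a⁻¹ * L), Metric.ball x₀ r, Metric.ball_mem_nhds x₀ hr,
    fun x hx y hy hxX hyX n hn => ?_⟩
  obtain ⟨hax, hxt, hxs⟩ := hball x hx
  obtain ⟨hay, hyt, hys⟩ := hball y hy
  obtain ⟨c, hc⟩ := h.exists_inner_eq two_ne_zero hxs hxX hn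
  have hc_le : |c| ≤ a⁻¹ := by
    have h1 : |c| * ‖fderiv ℝ f x‖ = 1 := by
      have : innerSL ℝ n = c • fderiv ℝ f x := by
        ext w; simpa using hc w
      rw [← Real.norm_eq_abs, ← norm_smul, ← this, innerSL_apply_norm, hn.1]
    rw [le_inv_comm₀ (by by_contra! hc0; simp [le_antisymm hc0 (abs_nonneg c)] at h1) ha0,
      ← eq_inv_of_mul_eq_one_right h1]
    exact hax.le
  have hLxy : ‖fderiv ℝ f x - fderiv ℝ f y‖ ≤ L * ‖y - x‖ := by
    have := hL.norm_sub_le hxt hyt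
    rwa [norm_sub_rev x y] at this
  have hLn : 0 ≤ a⁻¹ * L * ‖y - x‖ := by positivity
  refine ⟨?_, fun m hm hnm => ?_⟩
  · have hseg : ∀ z ∈ segment ℝ x y, z ∈ Metric.ball x₀ r :=
      fun z hz => (convex_ball x₀ r).segment_subset hx hy hz
    have hmv : ‖f y - f x - fderiv ℝ f x (y - x)‖ ≤ (L * ‖y - x‖) * ‖y - x‖ := by
      refine (convex_segment x y).norm_image_sub_le_of_norm_fderiv_le' (fun z hz => ?_)
        (fun z hz => ?_) (left_mem_segment ℝ x y) (right_mem_segment ℝ x y)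
      · exact (h.contDiffAt_chartHeight (hball z (hseg z hz)).2.2).differentiableAt two_ne_zero
      · refine (hL.norm_sub_le (hball z (hseg z hz)).2.1 hxt).trans ?_
        gcongr
        obtain ⟨θ, hθ, rfl⟩ := (segment_eq_image' ℝ x y) ▸ hz
        rw [add_sub_cancel_left, norm_smul, Real.norm_eq_abs, abs_of_nonneg hθ.1]
        exact mul_le_of_le_one_left (norm_nonneg _) hθ.2
    have hfx : f x = 0 := ((h.mem_iff x hxs).1 hxX).1
    have hfy : f y = 0 := ((h.mem_iff y hys).1 hyX).1
    rw [hfx, hfy, sub_zero, zero_sub, norm_neg, Real.norm_eq_abs] at hmv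
    rw [hc, abs_mul]
    calc |c| * |fderiv ℝ f x (y - x)| ≤ a⁻¹ * (L * ‖y - x‖ * ‖y - x‖) := by gcongr
      _ ≤ 2 * (a⁻¹ * L) * ‖y - x‖ ^ 2 := by nlinarith [mul_nonneg hLn (norm_nonneg (y - x))]
  · obtain ⟨c', hc'⟩ := h.exists_inner_eq two_ne_zero hys hyX hm
    have hc'0 : c' ≠ 0 := by
      rintro rfl
      have := hc' m
      rw [real_inner_self_eq_norm_sq, hm.1] at this
      simp at this
    rw [mul_assoc]
    -- A vector orthogonal to the normal at `y` is annihilated by `df(y)`, so that only the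
    -- variation of `df` contributes to `⟪n, w⟫`.
    refine norm_sub_le_of_inner_le hn.1 hm.1 hnm hLn fun w hw => ?_
    have hw0 : fderiv ℝ f y w = 0 := by
      rw [hc'] at hw
      exact (mul_eq_zero.1 hw).resolve_left hc'0
    calc ⟪n, w⟫ = c * ((fderiv ℝ f x - fderiv ℝ f y) w) := by
          rw [hc, sub_apply, hw0, sub_zero]
      _ ≤ |c * ((fderiv ℝ f x - fderiv ℝ f y) w)| := le_abs_self _
      _ ≤ a⁻¹ * (L * ‖y - x‖ * ‖w‖) := by
          rw [abs_mul]
          gcongr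
          exact ((fderiv ℝ f x - fderiv ℝ f y).le_opNorm w).trans (by gcongr)
      _ = a⁻¹ * L * ‖y - x‖ * ‖w‖ := by ring

/-- Near a pair of distinct points the bounds hold for trivial reasons, and near a pair of equal
points they come from a chart; compactness of `X × X` gives one constant. -/
lemma exists_normalBoundsAt {X : Set R3} (hX : IsSurface 2 X) (hc : IsCompact X) :
    ∃ K : ℝ, 0 ≤ K ∧ ∀ x ∈ X, ∀ y ∈ X, NormalBoundsAt X K x y := by
  have key : ∃ K : ℝ, ∀ p ∈ X ×ˢ X, p.1 ∈ X → p.2 ∈ X → NormalBoundsAt X K p.1 p.2 := by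
    refine (hc.prod hc).induction_on
      (p := fun S => ∃ K : ℝ, ∀ p ∈ S, p.1 ∈ X → p.2 ∈ X → NormalBoundsAt X K p.1 p.2)
      ⟨0, by simp⟩ (fun S S' hSS' ⟨K, hK⟩ => ⟨K, fun p hp => hK p (hSS' hp)⟩) ?_ ?_
    · rintro S S' ⟨K, hK⟩ ⟨K', hK'⟩
      refine ⟨max K K', fun p hp h1 h2 => hp.elim (fun hp => ?_) (fun hp => ?_)⟩
      · exact (hK p hp h1 h2).mono (le_max_left _ _)
      · exact (hK' p hp h1 h2).mono (le_max_right _ _)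
    · rintro ⟨x, y⟩ ⟨hx, hy⟩
      by_cases hxy : x = y
      · subst hxy
        obtain ⟨Φ, hΦ, hxΦ⟩ := hX x hx
        obtain ⟨K, U, hU, hK⟩ := hΦ.eventually_normalBoundsAt hxΦ
        exact ⟨U ×ˢ U, mem_nhdsWithin_of_mem_nhds (prod_mem_nhds hU hU), K,
          fun p hp h1 h2 => hK _ hp.1 _ hp.2 h1 h2⟩
      · have hd : 0 < ‖y - x‖ := norm_pos_iff.2 (sub_ne_zero.2 (Ne.symm hxy))
        have hcont : Continuous fun p : R3 × R3 => ‖p.2 - p.1‖ := by fun_prop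
        refine ⟨{p | ‖y - x‖ / 2 < ‖p.2 - p.1‖}, mem_nhdsWithin_of_mem_nhds
          (hcont.continuousAt.eventually (lt_mem_nhds (half_lt_self hd))), 4 / ‖y - x‖, ?_⟩
        rintro ⟨p, q⟩ hpq - - n hn
        have h1 : 2 ≤ 4 / ‖y - x‖ * ‖q - p‖ := by
          rw [div_mul_eq_mul_div, le_div_iff₀ hd]
          have : ‖y - x‖ / 2 < ‖q - p‖ := hpq
          linarith
        refine ⟨?_, fun m hm _ => ?_⟩
        · refine (abs_real_inner_le_norm _ _).trans ?_
          rw [hn.1, pow_two, ← mul_assoc]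
          gcongr
          linarith
        · refine (norm_sub_le n m).trans ?_
          rw [hn.1, hm.1]
          linarith
  obtain ⟨K, hK⟩ := key
  exact ⟨max K 0, le_max_right _ _, fun x hx y hy =>
    (hK (x, y) ⟨hx, hy⟩ hx hy).mono (le_max_left _ _)⟩

/-! ### Nearest points and the normal neighbourhood -/

lemma IsUnitNormalAt.neg {Y : Set R3} {x n : R3} (h : IsUnitNormalAt Y x n) :
    IsUnitNormalAt Y x (-n) :=
  ⟨by rw [norm_neg, h.1], fun w hw => by rw [inner_neg_left, h.2 w hw, neg_zero]⟩

/-- Moving by less than `1 / (2 K)` along the normals of `X` contracts distances at most by the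
factor `1 - 2 h K`. -/
lemma norm_sub_le_norm_normal_add_sub {X : Set R3} {K h t s : ℝ} {x y n m : R3}
    (hxy : NormalBoundsAt X K x y) (hyx : NormalBoundsAt X K y x)
    (hn : IsUnitNormalAt X x n) (hm : IsUnitNormalAt X y m) (ht : |t| ≤ h) (hs : |s| ≤ h) :
    (1 - 2 * h * K) * ‖x - y‖ ≤ ‖(x + t • n) - (y + s • m)‖ := by
  rcases eq_or_ne x y with rfl | hne
  · simp
  have hpos : 0 < ‖x - y‖ := norm_pos_iff.2 (sub_ne_zero.2 hne)
  have h1 : |⟪n, x - y⟫| ≤ K * ‖x - y‖ ^ 2 := by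
    have := (hxy n hn).1
    rwa [← neg_sub x y, inner_neg_right, abs_neg, norm_neg] at this
  have h2 : |⟪m, x - y⟫| ≤ K * ‖x - y‖ ^ 2 := (hyx m hm).1
  have h3 : |t * ⟪n, x - y⟫| ≤ h * (K * ‖x - y‖ ^ 2) := by
    rw [abs_mul]
    gcongr
    exact (abs_nonneg t).trans ht
  have h4 : |s * ⟪m, x - y⟫| ≤ h * (K * ‖x - y‖ ^ 2) := by
    rw [abs_mul]
    gcongr
    exact (abs_nonneg t).trans ht
  have h5 : ⟪(x + t • n) - (y + s • m), x - y⟫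
      = ‖x - y‖ ^ 2 + t * ⟪n, x - y⟫ - s * ⟪m, x - y⟫ := by
    rw [show (x + t • n) - (y + s • m) = (x - y) + t • n - s • m by abel, inner_sub_left,
      inner_add_left, real_inner_smul_left, real_inner_smul_left, real_inner_self_eq_norm_sq]
  have h6 := real_inner_le_norm ((x + t • n) - (y + s • m)) (x - y)
  rw [h5] at h6
  refine le_of_mul_le_mul_right ?_ hpos
  nlinarith [(abs_le.1 h3).1, (abs_le.1 h4).2]

lemma proj_normal_add {X : Set R3} {K h t : ℝ} {x n : R3}
    (hX : ∀ x ∈ X, ∀ y ∈ X, NormalBoundsAt X K x y) (hh : 2 * h * K < 1) (hx : x ∈ X)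
    (hn : IsUnitNormalAt X x n) (ht : |t| ≤ h) : proj X (x + t • n) = x := by
  have key : ∀ y ∈ X, y ≠ x → dist (x + t • n) x < dist (x + t • n) y := by
    intro y hy hne
    have hpos : 0 < ‖x - y‖ := norm_pos_iff.2 (sub_ne_zero.2 hne.symm)
    have h1 : |⟪x - y, n⟫| ≤ K * ‖x - y‖ ^ 2 := by
      have := (hX x hx y hy n hn).1
      rwa [← neg_sub x y, inner_neg_right, abs_neg, norm_neg, real_inner_comm] at this
    have h2 : |t * ⟪x - y, n⟫| ≤ h * (K * ‖x - y‖ ^ 2) := by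
      rw [abs_mul]
      gcongr
      exact (abs_nonneg t).trans ht
    rw [dist_eq_norm, dist_eq_norm]
    refine lt_of_pow_lt_pow_left₀ 2 (norm_nonneg _) ?_
    rw [add_sub_cancel_left, show x + t • n - y = (x - y) + t • n by abel, norm_add_sq_real,
      real_inner_smul_right]
    nlinarith [(abs_le.1 h2).1, mul_pos hpos hpos]
  have hle : ∀ y ∈ X, dist (x + t • n) x ≤ dist (x + t • n) y := fun y hy => by
    rcases eq_or_ne y x with rfl | hne
    exacts [le_rfl, (key y hy hne).le]
  have hdist : dist (x + t • n) x = Metric.infDist (x + t • n) X :=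
    le_antisymm ((Metric.le_infDist ⟨x, hx⟩).2 fun {y} hy => hle y hy)
      (Metric.infDist_le_dist_of_mem hx)
  have hp : IsProjection X (x + t • n) (proj X (x + t • n)) :=
    Classical.epsilon_spec (p := IsProjection X (x + t • n)) ⟨x, hx, hdist⟩
  by_contra hne
  exact (key _ hp.1 hne).ne (hdist.trans hp.2.symm)

lemma proj_lipschitz_on_normalNhd {X : Set R3} {K h : ℝ}
    (hX : ∀ x ∈ X, ∀ y ∈ X, NormalBoundsAt X K x y) (hh : 2 * h * K < 1) {p q : R3}
    (hp : p ∈ normalNhd X h) (hq : q ∈ normalNhd X h) :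
    (1 - 2 * h * K) * dist (proj X p) (proj X q) ≤ dist p q := by
  obtain ⟨x, hx, n, hn, t, ht, rfl⟩ := hp
  obtain ⟨y, hy, m, hm, s, hs, rfl⟩ := hq
  have ht' : |t| ≤ h := (abs_lt.2 ht).le
  have hs' : |s| ≤ h := (abs_lt.2 hs).le
  rw [proj_normal_add hX hh hx hn ht', proj_normal_add hX hh hy hm hs', dist_eq_norm,
    dist_eq_norm]
  exact norm_sub_le_norm_normal_add_sub (hX x hx y hy) (hX y hy x hx) hn hm ht' hs'

lemma proj_continuousOn_normalNhd {X : Set R3} {K h : ℝ}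
    (hX : ∀ x ∈ X, ∀ y ∈ X, NormalBoundsAt X K x y) (hh : 2 * h * K < 1) :
    ContinuousOn (proj X) (normalNhd X h) := by
  refine (LipschitzOnWith.of_dist_le_mul (K := (1 - 2 * h * K)⁻¹.toNNReal)
    fun p hp q hq => ?_).continuousOn
  have h0 : 0 < 1 - 2 * h * K := by linarith
  rw [Real.coe_toNNReal _ (inv_nonneg.2 h0.le), inv_mul_eq_div, le_div_iff₀' h0]
  exact proj_lipschitz_on_normalNhd hX hh hp hq

/-- Two points of a plane with unit normal `μ` that lie on normals of `X` nearly parallel to `μ`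
are not much further apart than their feet `x` and `y` on `X`. -/
lemma norm_normal_add_sub_le {X : Set R3} {K h c t s : ℝ} {x y n m μ : R3} (hK : 0 ≤ K)
    (hxy : NormalBoundsAt X K x y) (hn : IsUnitNormalAt X x n) (hm : IsUnitNormalAt X y m)
    (hs : |s| ≤ h) (hc : c ≤ 1 / 2) (hnμ : ‖n - μ‖ ≤ c) (hmμ : ‖m - μ‖ ≤ c)
    (hμ : ⟪μ, (x + t • n) - (y + s • m)⟫ = 0) :
    (1 - c) * ‖(x + t • n) - (y + s • m)‖ ≤ (1 + h * K) * (1 + c) * ‖x - y‖ := by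
  have hc0 : 0 ≤ c := (norm_nonneg _).trans hnμ
  have hh0 : 0 ≤ h := (abs_nonneg _).trans hs
  set d : R3 := (x + t • n) - (y + s • m) with hd
  have hdec : d = (x - y) + (t - s) • n + s • (n - m) := by rw [hd]; module
  -- Being close to `μ`, both normals are on the same side, as the Lipschitz bound requires.
  have hnm : ‖n - m‖ ≤ K * ‖x - y‖ := by
    have h1 : ‖n - m‖ ≤ 1 := by
      calc ‖n - m‖ = ‖(n - μ) - (m - μ)‖ := by rw [sub_sub_sub_cancel_right]
        _ ≤ ‖n - μ‖ + ‖m - μ‖ := norm_sub_le _ _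
        _ ≤ 1 := by linarith
    have h2 := norm_sub_sq_real n m
    rw [hn.1, hm.1] at h2
    have h3 : 0 ≤ ⟪n, m⟫ := by nlinarith [norm_nonneg (n - m)]
    rw [norm_sub_rev x y]
    exact (hxy n hn).2 m hm h3
  have hsnm : ‖s • (n - m)‖ ≤ h * K * ‖x - y‖ := by
    rw [norm_smul, Real.norm_eq_abs, mul_assoc]
    gcongr
  have hdn : |⟪d, n⟫| ≤ c * ‖d‖ := by
    have : ⟪d, n⟫ = ⟪d, n - μ⟫ := by
      rw [inner_sub_right, real_inner_comm, real_inner_comm μ d, hμ, sub_zero]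
    rw [this, mul_comm]
    exact (abs_real_inner_le_norm _ _).trans (by gcongr)
  have hts : |t - s| ≤ ‖d‖ + (1 + h * K) * ‖x - y‖ := by
    have h1 : (t - s) • n = d - (x - y) - s • (n - m) := by rw [hdec]; abel
    have h2 : |t - s| = ‖(t - s) • n‖ := by rw [norm_smul, hn.1, mul_one, Real.norm_eq_abs]
    rw [h2, h1]
    linarith [norm_sub_le (d - (x - y)) (s • (n - m)), norm_sub_le d (x - y)]
  have hdd : ‖d‖ ^ 2 = ⟪d, x - y⟫ + (t - s) * ⟪d, n⟫ + ⟪d, s • (n - m)⟫ := by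
    rw [← real_inner_self_eq_norm_sq, ← real_inner_smul_right, ← inner_add_right,
      ← inner_add_right, ← hdec]
  rcases eq_or_lt_of_le (norm_nonneg d) with h0 | h0
  · rw [← h0, mul_zero]; positivity
  refine le_of_mul_le_mul_right ?_ h0
  have e1 : ⟪d, x - y⟫ ≤ ‖d‖ * ‖x - y‖ := real_inner_le_norm _ _
  have e2 : ⟪d, s • (n - m)⟫ ≤ ‖d‖ * (h * K * ‖x - y‖) :=
    (real_inner_le_norm _ _).trans (by gcongr)
  have e3 : (t - s) * ⟪d, n⟫ ≤ (‖d‖ + (1 + h * K) * ‖x - y‖) * (c * ‖d‖) := by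
    refine (le_abs_self _).trans ?_
    rw [abs_mul]
    gcongr
  nlinarith

/-- The orientation parametrises the normal neighbourhood by `X × (-h, h)`, injectively for small
`h`, so that the neighbourhood is a Borel set. -/
lemma measurableSet_normalNhd {X : Set R3} {K h : ℝ} (hXs : IsCompactOrientedSurface X)
    (hX : ∀ x ∈ X, ∀ y ∈ X, NormalBoundsAt X K x y) (hh : 2 * h * K < 1) :
    MeasurableSet (normalNhd X h) := by
  obtain ⟨N, hNc, hN⟩ := hXs.orientable
  have hpm : ∀ x ∈ X, ∀ n, IsUnitNormalAt X x n → n = N x ∨ n = -N x := by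
    intro x hx n hn
    -- On the diagonal the Lipschitz bound says that the normal is unique up to sign.
    have hz : ∀ m, IsUnitNormalAt X x m → 0 ≤ ⟪n, m⟫ → n = m := fun m hm hnm => by
      have := (hX x hx x hx n hn).2 m hm hnm
      rw [sub_self, norm_zero, mul_zero] at this
      exact sub_eq_zero.1 (norm_le_zero_iff.1 this)
    rcases le_total 0 ⟪n, N x⟫ with h0 | h0
    · exact Or.inl (hz _ (hN x hx) h0)
    · exact Or.inr (hz _ (hN x hx).neg (by rw [inner_neg_right]; linarith))
  have himg : normalNhd X h = (fun p : R3 × ℝ => p.1 + p.2 • N p.1) '' (X ×ˢ Ioo (-h) h) := by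
    ext z
    constructor
    · rintro ⟨x, hx, n, hn, t, ht, rfl⟩
      rcases hpm x hx n hn with rfl | rfl
      · exact ⟨(x, t), ⟨hx, ht⟩, rfl⟩
      · exact ⟨(x, -t), ⟨hx, by constructor <;> linarith [ht.1, ht.2]⟩, by simp⟩
    · rintro ⟨⟨x, t⟩, ⟨hx, ht⟩, rfl⟩
      exact ⟨x, hx, N x, hN x hx, t, ht, rfl⟩
  rw [himg]
  refine (hXs.isCompact.measurableSet.prod measurableSet_Ioo).image_of_continuousOn_injOn ?_ ?_
  · exact continuousOn_fst.add (continuousOn_snd.smul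
      (hNc.comp continuousOn_fst fun p hp => hp.1))
  · rintro ⟨x, t⟩ ⟨hx, ht⟩ ⟨y, s⟩ ⟨hy, hs⟩ heq
    simp only at heq hx hy ht hs
    have hxy : x = y := by
      rw [← proj_normal_add hX hh hx (hN x hx) (abs_lt.2 ht).le, heq,
        proj_normal_add hX hh hy (hN y hy) (abs_lt.2 hs).le]
    subst hxy
    have h1 : (t - s) • N x = 0 := by
      rw [sub_smul, sub_eq_zero]; exact add_left_cancel heq
    rcases smul_eq_zero.1 h1 with h2 | h2
    · rw [sub_eq_zero.1 h2]
    · have := (hN x hx).1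
      simp [h2] at this

/-! ### Areas of Lipschitz images -/

lemma LipschitzOnWith.euclideanHausdorffMeasure_image_le {E F : Type*} [MetricSpace E]
    [MeasurableSpace E] [BorelSpace E] [MetricSpace F] [MeasurableSpace F] [BorelSpace F]
    {K : NNReal} {f : E → F} {s : Set E} (hf : LipschitzOnWith K f s) (d : ℕ) :
    μHE[d] (f '' s) ≤ (K : ENNReal) ^ d * μHE[d] s := by
  simp only [Measure.euclideanHausdorffMeasure_def, Measure.smul_apply, ENNReal.smul_def,
    smul_eq_mul]
  rw [mul_left_comm]
  gcongr
  simpa using hf.hausdorffMeasure_image_le (d := (d : ℝ)) (Nat.cast_nonneg d)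

lemma area_image_le {f : R3 → R3} {s : Set R3} {c : ℝ}
    (hf : ∀ p ∈ s, ∀ q ∈ s, dist (f p) (f q) ≤ c * dist p q) :
    area (f '' s) ≤ ENNReal.ofReal c ^ 2 * area s := by
  refine LipschitzOnWith.euclideanHausdorffMeasure_image_le (K := c.toNNReal)
    (LipschitzOnWith.of_dist_le_mul fun p hp q hq => (hf p hp q hq).trans ?_) 2
  gcongr
  exact Real.le_coe_toNNReal c

lemma area_le_area_image {f : R3 → R3} {s : Set R3} {c : ℝ}
    (hf : ∀ p ∈ s, ∀ q ∈ s, dist p q ≤ c * dist (f p) (f q)) :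
    area s ≤ ENNReal.ofReal c ^ 2 * area (f '' s) := by
  have hinj : InjOn f s := fun p hp q hq hpq => by
    have := hf p hp q hq
    rw [hpq, dist_self, mul_zero] at this
    exact dist_le_zero.1 this
  have himg : Function.invFunOn f s '' (f '' s) = s := by
    rw [image_image]
    exact (image_congr fun p hp => hinj.leftInvOn_invFunOn hp).trans (image_id' s)
  conv_lhs => rw [← himg]
  refine area_image_le ?_
  rintro _ ⟨p, hp, rfl⟩ _ ⟨q, hq, rfl⟩
  rw [hinj.leftInvOn_invFunOn hp, hinj.leftInvOn_invFunOn hq]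
  exact hf p hp q hq

lemma area_segment (a b : R3) : area (segment ℝ a b) = 0 := by
  refine (Measure.euclideanHausdorffMeasure_zero_or_top one_lt_two _).resolve_right ?_
  simp only [Measure.euclideanHausdorffMeasure_def, Measure.smul_apply, ENNReal.smul_def,
    smul_eq_mul, Nat.cast_one, hausdorffMeasure_segment]
  exact ENNReal.mul_ne_top ENNReal.coe_ne_top (edist_ne_top a b)

/-- Near each of its points a surface is the image of a bounded planar set under the inverse of a
chart. -/
lemma IsCompactOrientedSurface.area_lt_top {X : Set R3} (hX : IsCompactOrientedSurface X) :
    area X < ⊤ := by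
  refine hX.isCompact.measure_lt_top_of_nhdsWithin fun x hx => ?_
  obtain ⟨Φ, hΦ, hxΦ⟩ := hX.isSurface x hx
  let j : EuclideanSpace ℝ (Fin 2) → R3 := fun u => !₂[u 0, u 1, 0]
  let P : R3 → EuclideanSpace ℝ (Fin 2) := fun w => !₂[w 0, w 1]
  have hjP : ∀ w : R3, w 2 = 0 → j (P w) = w := by
    intro w hw
    ext i
    fin_cases i <;> simp [j, P, hw]
  have hj : ContDiff ℝ 1 j := by
    rw [contDiff_euclidean]
    intro i
    fin_cases i <;> simp [j] <;> fun_prop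
  have hP : Continuous P := by
    dsimp only [P]
    fun_prop
  have hx2 : Φ x 2 = 0 := ((hΦ.mem_iff x hxΦ).1 hx).1
  have hG : ContDiffAt ℝ 1 (Φ.symm ∘ j) (P (Φ x)) := by
    refine ContDiffAt.comp _ ?_ hj.contDiffAt
    rw [hjP _ hx2]
    exact (hΦ.contDiffAt_symm hxΦ).of_le (by norm_num)
  obtain ⟨K, t, ht, hK⟩ := hG.exists_lipschitzOnWith
  obtain ⟨r, hr, hrt⟩ := Metric.mem_nhds_iff.1 ht
  have hPΦ : ContinuousAt (fun z => P (Φ z)) x :=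
    hP.continuousAt.comp (Φ.continuousAt hxΦ)
  have hU : ∀ᶠ z in 𝓝 x, z ∈ Φ.source ∧ P (Φ z) ∈ Metric.ball (P (Φ x)) r :=
    Filter.Eventually.and (Φ.open_source.mem_nhds hxΦ) (hPΦ.eventually (Metric.ball_mem_nhds _ hr))
  refine ⟨X ∩ {z | z ∈ Φ.source ∧ P (Φ z) ∈ Metric.ball (P (Φ x)) r},
    inter_mem self_mem_nhdsWithin (mem_nhdsWithin_of_mem_nhds hU), ?_⟩
  have hsub : X ∩ {z | z ∈ Φ.source ∧ P (Φ z) ∈ Metric.ball (P (Φ x)) r}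
      ⊆ (Φ.symm ∘ j) '' Metric.ball (P (Φ x)) r := by
    rintro z ⟨hzX, hzs, hzb⟩
    refine ⟨P (Φ z), hzb, ?_⟩
    rw [Function.comp_apply, hjP _ ((hΦ.mem_iff z hzs).1 hzX).1, Φ.left_inv hzs]
  refine (measure_mono hsub).trans_lt
    (((hK.mono hrt).euclideanHausdorffMeasure_image_le 2).trans_lt ?_)
  rw [EuclideanSpace.euclideanHausdorffMeasure_eq_volume]
  exact ENNReal.mul_lt_top (by simp) measure_ball_lt_top

/-! ### Triangles -/

lemma Triangulation.area_inter_eq_zero (T : Triangulation) {s t : Finset R3}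
    (hs : s ∈ T.triangles) (ht : t ∈ T.triangles) (hst : s ≠ t) :
    area (convexHull ℝ (s : Set R3) ∩ convexHull ℝ (t : Set R3)) = 0 := by
  classical
  rw [T.inter_eq s hs t ht hst, ← Finset.coe_inter]
  have hcard : (s ∩ t).card ≤ 2 := by
    by_contra! h3
    have h1 : s ∩ t = s :=
      Finset.eq_of_subset_of_card_le Finset.inter_subset_left (by rw [T.card_eq s hs]; exact h3)
    have h2 : s ∩ t = t :=
      Finset.eq_of_subset_of_card_le Finset.inter_subset_right (by rw [T.card_eq t ht]; exact h3)
    exact hst (h1.symm.trans h2)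
  obtain ⟨a, b, hab⟩ : ∃ a b : R3, ((s ∩ t : Finset R3) : Set R3) ⊆ {a, b} := by
    generalize s ∩ t = u at hcard
    interval_cases hu : u.card
    · exact ⟨0, 0, by simp [Finset.card_eq_zero.1 hu]⟩
    · obtain ⟨a, rfl⟩ := Finset.card_eq_one.1 hu
      exact ⟨a, a, by simp⟩
    · obtain ⟨a, b, -, rfl⟩ := Finset.card_eq_two.1 hu
      exact ⟨a, b, by simp⟩
  refine measure_mono_null (convexHull_mono hab) ?_
  rw [convexHull_pair]
  exact area_segment a b

lemma exists_unit_mem_vectorSpan_orthogonal {s : Finset R3} (hs : s.card = 3) :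
    ∃ μ : R3, ‖μ‖ = 1 ∧ μ ∈ (vectorSpan ℝ (s : Set R3))ᗮ := by
  classical
  have hne : (vectorSpan ℝ (s : Set R3))ᗮ ≠ ⊥ := by
    intro h
    have h1 : vectorSpan ℝ (s : Set R3) = ⊤ := Submodule.orthogonal_eq_bot_iff.1 h
    have h2 := finrank_vectorSpan_image_finset_le ℝ (id : R3 → R3) s (n := 2) hs
    rw [Finset.image_id, h1, finrank_top, finrank_euclideanSpace_fin] at h2
    omega
  obtain ⟨v, hv, hv0⟩ := Submodule.exists_mem_ne_zero_of_ne_bot hne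
  exact ⟨(‖v‖⁻¹ : ℝ) • v, norm_smul_inv_norm hv0, Submodule.smul_mem _ _ hv⟩

lemma inner_sub_eq_zero_of_mem_convexHull {s : Set R3} {μ p q : R3}
    (hμ : μ ∈ (vectorSpan ℝ s)ᗮ) (hp : p ∈ convexHull ℝ s) (hq : q ∈ convexHull ℝ s) :
    ⟪μ, p - q⟫ = 0 := by
  refine Submodule.inner_left_of_mem_orthogonal ?_ hμ
  rw [← direction_affineSpan]
  exact AffineSubspace.vsub_mem_direction (convexHull_subset_affineSpan s hp)
    (convexHull_subset_affineSpan s hq)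

/-- A chord of the unit sphere is at most as long as the arc. -/
lemma norm_sub_le_angle {n m : R3} (hn : ‖n‖ = 1) (hm : ‖m‖ = 1) :
    ‖n - m‖ ≤ InnerProductGeometry.angle n m := by
  refine le_of_sq_le_sq ?_ (InnerProductGeometry.angle_nonneg n m)
  have h1 := Real.one_sub_sq_div_two_le_cos (x := InnerProductGeometry.angle n m)
  rw [InnerProductGeometry.cos_angle, hn, hm, mul_one, div_one] at h1
  rw [norm_sub_sq_real, hn, hm]
  linarith

lemma norm_sub_le_or_of_lineAngle_le {n m : R3} (hn : ‖n‖ = 1) (hm : ‖m‖ = 1) {c : ℝ}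
    (h : lineAngle n m ≤ c) : ‖n - m‖ ≤ c ∨ ‖-n - m‖ ≤ c := by
  rcases min_le_iff.1 h with h | h
  · exact Or.inl ((norm_sub_le_angle hn hm).trans h)
  · rw [← InnerProductGeometry.angle_neg_left] at h
    exact Or.inr ((norm_sub_le_angle (by rwa [norm_neg]) hm).trans h)

lemma IsNormalAngleAt.le_maxAngle {X : Set R3} {T : Triangulation} {h a : ℝ} {x : R3}
    (hx : x ∈ T.inPart X h) (ha : IsNormalAngleAt X T x a) : a ≤ maxAngle X h T := by
  refine le_csSup ⟨Real.pi, ?_⟩ ⟨x, hx, ha⟩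
  rintro _ ⟨_, -, _, -, -, m, -, -, n, -, rfl⟩
  exact (min_le_left _ _).trans (InnerProductGeometry.angle_le_pi n m)

/-- On a triangle whose normal makes small angles with the normals of `X`, the nearest-point
projection does not decrease distances much. -/
lemma dist_le_dist_proj_on_triangle {X : Set R3} {T : Triangulation} {K h c : ℝ} (hK : 0 ≤ K)
    (hX : ∀ x ∈ X, ∀ y ∈ X, NormalBoundsAt X K x y) (hh : 2 * h * K < 1) (hc : c ≤ 1 / 2)
    (hα : maxAngle X h T ≤ c) {s : Finset R3} (hs : s ∈ T.triangles) {p q : R3}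
    (hp : p ∈ convexHull ℝ (s : Set R3) ∩ normalNhd X h)
    (hq : q ∈ convexHull ℝ (s : Set R3) ∩ normalNhd X h) :
    dist p q ≤ (1 + h * K) * (1 + c) / (1 - c) * dist (proj X p) (proj X q) := by
  obtain ⟨μ, hμ1, hμ⟩ := exists_unit_mem_vectorSpan_orthogonal (T.card_eq s hs)
  -- The normal at the foot point can be chosen on the same side of `X` as `μ`.
  have hfoot : ∀ z ∈ convexHull ℝ (s : Set R3) ∩ normalNhd X h, ∃ x ∈ X, ∃ n,
      IsUnitNormalAt X x n ∧ ∃ t : ℝ, |t| ≤ h ∧ z = x + t • n ∧ proj X z = x ∧ ‖n - μ‖ ≤ c := by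
    rintro z ⟨hzs, hzN⟩
    have hzin : z ∈ T.inPart X h := ⟨mem_biUnion hs hzs, hzN⟩
    obtain ⟨x, hx, n, hn, t, ht, rfl⟩ := hzN
    have ht' : |t| ≤ h := (abs_lt.2 ht).le
    have hproj := proj_normal_add hX hh hx hn ht'
    have ha : IsNormalAngleAt X T (x + t • n) (lineAngle n μ) :=
      ⟨s, hs, hzs, μ, hμ1, hμ, n, hproj.symm ▸ hn, rfl⟩
    rcases norm_sub_le_or_of_lineAngle_le hn.1 hμ1 ((ha.le_maxAngle hzin).trans hα) with h1 | h1
    · exact ⟨x, hx, n, hn, t, ht', rfl, hproj, h1⟩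
    · exact ⟨x, hx, -n, hn.neg, -t, by rwa [abs_neg], by simp, hproj, h1⟩
  obtain ⟨x, hx, n, hn, t, -, rfl, hpx, hnμ⟩ := hfoot p hp
  obtain ⟨y, hy, m, hm, r, hr, rfl, hqy, hmμ⟩ := hfoot q hq
  rw [hpx, hqy, dist_eq_norm, dist_eq_norm, div_mul_eq_mul_div, le_div_iff₀' (by linarith)]
  exact norm_normal_add_sub_le hK (hX x hx y hy) hn hm hr hc hnμ hmμ
    (inner_sub_eq_zero_of_mem_convexHull hμ hp.1 hq.1)

/-! ### Comparison of the areas -/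

lemma area_le_area_inPart {X : Set R3} {T : Triangulation} {K h : ℝ}
    (hX : ∀ x ∈ X, ∀ y ∈ X, NormalBoundsAt X K x y) (hh : 2 * h * K < 1)
    (hT : SurjOn (proj X) (T.inPart X h) X) :
    area X ≤ ENNReal.ofReal (1 - 2 * h * K)⁻¹ ^ 2 * area (T.inPart X h) := by
  refine (measure_mono hT).trans (area_image_le fun p hp q hq => ?_)
  rw [inv_mul_eq_div, le_div_iff₀' (by linarith)]
  exact proj_lipschitz_on_normalNhd hX hh hp.2 hq.2

/-- The projections of the triangles overlap only in images of edges, so that their areas add up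
to at most the area of `X`. -/
lemma area_inPart_le {X : Set R3} (hXs : IsCompactOrientedSurface X) {T : Triangulation}
    {K h c : ℝ} (hK : 0 ≤ K) (hX : ∀ x ∈ X, ∀ y ∈ X, NormalBoundsAt X K x y)
    (hh : 2 * h * K < 1) (hc : c ≤ 1 / 2) (hα : maxAngle X h T ≤ c)
    (hT : BijOn (proj X) (T.inPart X h) X) :
    area (T.inPart X h)
      ≤ ENNReal.ofReal ((1 + h * K) * (1 + c) / (1 - c)) ^ 2 * area X := by
  let S : Finset R3 → Set R3 := fun s => convexHull ℝ (s : Set R3) ∩ normalNhd X h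
  have hSin : ∀ s ∈ T.triangles, S s ⊆ T.inPart X h := fun s hs p hp =>
    ⟨mem_biUnion hs hp.1, hp.2⟩
  have hdisj : (T.triangles : Set (Finset R3)).Pairwise
      (Function.onFun (AEDisjoint (μHE[2] : Measure R3)) fun s => proj X '' S s) := by
    intro s hs t ht hst
    have hnull : area (S s ∩ S t) = 0 :=
      measure_mono_null (inter_subset_inter inter_subset_left inter_subset_left)
        (T.area_inter_eq_zero hs ht hst)
    have hinter : proj X '' S s ∩ proj X '' S t = proj X '' (S s ∩ S t) :=
      (hT.injOn.image_inter (hSin s hs) (hSin t ht)).symm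
    have hle : area (proj X '' (S s ∩ S t))
        ≤ ENNReal.ofReal (1 - 2 * h * K)⁻¹ ^ 2 * area (S s ∩ S t) := by
      refine area_image_le fun p hp q hq => ?_
      rw [inv_mul_eq_div, le_div_iff₀' (by linarith)]
      exact proj_lipschitz_on_normalNhd hX hh hp.1.2 hq.1.2
    rw [hnull, mul_zero, nonpos_iff_eq_zero, ← hinter] at hle
    exact hle
  have hmeas : ∀ s ∈ T.triangles, MeasurableSet (proj X '' S s) := by
    intro s hs
    have hS : MeasurableSet (S s) :=
      (s.finite_toSet.isCompact_convexHull (𝕜 := ℝ)).measurableSet.inter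
        (measurableSet_normalNhd hXs hX hh)
    exact hS.image_of_continuousOn_injOn
      ((proj_continuousOn_normalNhd hX hh).mono inter_subset_right)
      (hT.injOn.mono (hSin s hs))
  set lam := ENNReal.ofReal ((1 + h * K) * (1 + c) / (1 - c)) ^ 2
  calc area (T.inPart X h) ≤ area (⋃ s ∈ T.triangles, S s) := by
        refine measure_mono ?_
        rintro p ⟨hp, hpN⟩
        obtain ⟨s, hs, hps⟩ := mem_iUnion₂.1 hp
        exact mem_biUnion hs ⟨hps, hpN⟩
    _ ≤ ∑ s ∈ T.triangles, area (S s) := measure_biUnion_finset_le _ _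
    _ ≤ ∑ s ∈ T.triangles, lam * area (proj X '' S s) :=
        Finset.sum_le_sum fun s hs => area_le_area_image fun p hp q hq =>
          dist_le_dist_proj_on_triangle hK hX hh hc hα hs hp hq
    _ = lam * area (⋃ s ∈ T.triangles, proj X '' S s) := by
        rw [← Finset.mul_sum]
        congr 1
        exact (measure_biUnion_finset₀ hdisj fun s hs => (hmeas s hs).nullMeasurableSet).symm
    _ ≤ lam * area X := by
        gcongr
        refine measure_mono (iUnion₂_subset fun s hs => ?_)
        exact (image_mono (hSin s hs)).trans hT.mapsTo.image_subset

lemma Triangulation.area_carrier_le (T : Triangulation) (X : Set R3) (h : ℝ) :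
    area T.carrier ≤ area (T.inPart X h) + area (T.outPart X h) := by
  rw [← inter_union_sdiff T.carrier (normalNhd X h)]
  exact measure_union_le _ _

theorem mainTheorem8 (X : Set R3) (hX : IsCompactOrientedSurface X)
    (H : Set ℝ) (T : ℝ → Triangulation)
    (hT : ∃ C : ℝ, ∀ᶠ h in 𝓝[H ∩ Ioi 0] 0, IsAdmissible X C h (T h))
    (hα : ∃ C : ℝ, ∀ᶠ h in 𝓝[H ∩ Ioi 0] 0, maxAngle X h (T h) ≤ C * h) :
    area X < ⊤ ∧ Tendsto (fun h => area (T h).carrier) (𝓝[H ∩ Ioi 0] 0) (𝓝 (area X)) := by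
  have hfin : area X < ⊤ := hX.area_lt_top
  refine ⟨hfin, ?_⟩
  obtain ⟨C, hC⟩ := hT
  obtain ⟨A, hA⟩ := hα
  obtain ⟨K, hK, hXK⟩ := exists_normalBoundsAt hX.isSurface hX.isCompact
  have h0 : Tendsto (fun h : ℝ => h) (𝓝[H ∩ Ioi 0] 0) (𝓝 0) := nhdsWithin_le_nhds
  have hsmall : ∀ {a b : ℝ}, 0 < b → ∀ᶠ h in 𝓝[H ∩ Ioi 0] 0, a * h < b := fun {a b} hb => by
    have : Tendsto (fun h : ℝ => a * h) (𝓝[H ∩ Ioi 0] 0) (𝓝 (a * 0)) := h0.const_mul a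
    exact this.eventually (gt_mem_nhds (by simpa using hb))
  have hlow : Tendsto (fun h : ℝ => ENNReal.ofReal (1 - 2 * h * K) ^ 2 * area X)
      (𝓝[H ∩ Ioi 0] 0) (𝓝 (area X)) := by
    have hc : ContinuousAt (fun h : ℝ => 1 - 2 * h * K) 0 := by fun_prop
    have := ENNReal.Tendsto.mul_const (b := area X)
      (ENNReal.Tendsto.pow (n := 2) (ENNReal.tendsto_ofReal (hc.tendsto.comp h0)))
      (Or.inr hfin.ne)
    simpa using this
  have hup : Tendsto (fun h : ℝ => ENNReal.ofReal
        ((1 + h * K) * (1 + A * h) / (1 - A * h)) ^ 2 * area X + ENNReal.ofReal (C * h))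
      (𝓝[H ∩ Ioi 0] 0) (𝓝 (area X)) := by
    have hc : ContinuousAt (fun h : ℝ => (1 + h * K) * (1 + A * h) / (1 - A * h)) 0 :=
      ContinuousAt.div (by fun_prop) (by fun_prop) (by simp)
    have hc' : ContinuousAt (fun h : ℝ => C * h) 0 := by fun_prop
    have := (ENNReal.Tendsto.mul_const (b := area X)
      (ENNReal.Tendsto.pow (n := 2) (ENNReal.tendsto_ofReal (hc.tendsto.comp h0)))
      (Or.inr hfin.ne)).add (ENNReal.tendsto_ofReal (hc'.tendsto.comp h0))
    simpa using this
  refine tendsto_of_tendsto_of_tendsto_of_le_of_le' hlow hup ?_ ?_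
  · filter_upwards [hC, hsmall (a := 2 * K) one_pos] with h hadm hhK
    have hh : 2 * h * K < 1 := by linarith
    have hle := area_le_area_inPart hXK hh hadm.bijOn.surjOn
    have hpos : 0 < 1 - 2 * h * K := by linarith
    calc ENNReal.ofReal (1 - 2 * h * K) ^ 2 * area X
        ≤ ENNReal.ofReal (1 - 2 * h * K) ^ 2 *
          (ENNReal.ofReal (1 - 2 * h * K)⁻¹ ^ 2 * area ((T h).inPart X h)) := by gcongr
      _ = area ((T h).inPart X h) := by
          rw [← mul_assoc, ← mul_pow, ← ENNReal.ofReal_mul hpos.le, mul_inv_cancel₀ hpos.ne']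
          simp
      _ ≤ area (T h).carrier := measure_mono inter_subset_left
  · filter_upwards [hC, hA, hsmall (a := 2 * K) one_pos, hsmall (a := A) one_half_pos]
      with h hadm hAh hhK hhA
    refine ((T h).area_carrier_le X h).trans (add_le_add ?_ hadm.area_outPart_le)
    exact area_inPart_le hX hK hXK (by linarith) hhA.le hAh hadm.bijOn
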